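/- Let $m,n$ be non-negative integers, let $A,B,C,D\in\mathbb C^{m\times n}$, and let $t$ be an integer with $0\le t\le\min\{m,n\}$. Write $r(\cdot)$ for the rank of a matrix and $\mathbb C_t^{m\times n}$ for the set of all complex $m\times n$ matrices of rank exactly $t$. For $X\in\mathbb C^{m\times n}$ put $$\phi(X)=\begin{bmatrix}A-X&B-X\\ C-X&D-X\end{bmatrix},$$ and define $$G=[\,A-C,\ B-D\,],\qquad H=\begin{bmatrix}A-B\\ C-D\end{bmatrix},\qquad M=\begin{bmatrix}A&B\\ C&D\end{bmatrix}.$$ Then the following maximum and minimum are attained and are given by $$\max_{X\in\mathbb C_t^{m\times n}} r[\phi(X)]=\min\{\,r(G)+m,\ r(H)+n,\ r(M)+t\,\},$$ $$\min_{X\in\mathbb C_t^{m\times n}} r[\phi(X)]=\max\{\,r(G)+r(H)-r(A-B-C+D),\ r(G)+r(H)-r(M)+t,\ r(M)-t\,\}.$$ -/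

import Mathlib

/-- The set of all complex `m × n` matrices of rank exactly `t`. -/
def fixedRank (m n t : ℕ) : Set (Matrix (Fin m) (Fin n) ℂ) :=
  {X | X.rank = t}

/-- The matrix-valued function sending `X` to the block matrix with rows
`A - X, B - X` and `C - X, D - X`. -/
def phi {m n : ℕ} (A B C D X : Matrix (Fin m) (Fin n) ℂ) :
    Matrix (Fin m ⊕ Fin m) (Fin n ⊕ Fin n) ℂ :=
  Matrix.fromBlocks (A - X) (B - X) (C - X) (D - X)

/-- The row block matrix `[A - C, B - D]`. -/
def matG {m n : ℕ} (A B C D : Matrix (Fin m) (Fin n) ℂ) :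
    Matrix (Fin m) (Fin n ⊕ Fin n) ℂ :=
  Matrix.fromCols (A - C) (B - D)

/-- The column block matrix with blocks `A - B` (top) and `C - D` (bottom). -/
def matH {m n : ℕ} (A B C D : Matrix (Fin m) (Fin n) ℂ) :
    Matrix (Fin m ⊕ Fin m) (Fin n) ℂ :=
  Matrix.fromRows (A - B) (C - D)

/-- The block matrix with rows `A, B` and `C, D`. -/
def matM {m n : ℕ} (A B C D : Matrix (Fin m) (Fin n) ℂ) :
    Matrix (Fin m ⊕ Fin m) (Fin n ⊕ Fin n) ℂ :=
  Matrix.fromBlocks A B C D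

/-! Write `phi X` as M - P X Q with P = [I; I] and Q = [I, I]. Let S and N be difference maps, so
that ker S is the column space of P and SM = G, MN = H, SMN = A - B - C + D. For F = M - P X Q, SF =
SM and FN = MN whatever X is. The bounds then count dimensions: for the maximum,
`IsKernelPair.rank_le`, its transpose and subadditivity; for the minimum, Frobenius' inequality,
`IsKernelPair.rank_add_rank_add_rank_le` and subadditivity. For the maximum, X is grown by rank one
updates that raise r(F) until G or H saturates it. For the minimum, X first lowers the rank one for
one until Frobenius' inequality is tight (`IsKernelPair.exists_rank_sub_add_eq`), then grows at no
cost inside spaces determined by MN and SM, and only then at a cost of at most one per unit of rank.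
-/

open Module

set_option linter.unusedSectionVars false

/-! ### Column spaces and rank one updates. -/

namespace Matrix

variable {K : Type*} [Field K] {l m n k : Type*}
  [Fintype l] [Fintype m] [Fintype n] [Fintype k]

/-- The column space of a matrix. -/
abbrev colSpace (A : Matrix m n K) : Submodule K (m → K) := LinearMap.range A.mulVecLin

theorem mulVec_mem_colSpace (A : Matrix m n K) (x : n → K) : A *ᵥ x ∈ A.colSpace := ⟨x, rfl⟩

theorem finrank_colSpace (A : Matrix m n K) : finrank K A.colSpace = A.rank := rfl

theorem finrank_colSpace_transpose (A : Matrix m n K) : finrank K Aᵀ.colSpace = A.rank :=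
  rank_transpose A

theorem colSpace_mul (A : Matrix l m K) (B : Matrix m n K) :
    (A * B).colSpace = B.colSpace.map A.mulVecLin := by
  rw [colSpace, mulVecLin_mul, LinearMap.range_comp]

theorem colSpace_mul_le (A : Matrix l m K) (B : Matrix m n K) :
    (A * B).colSpace ≤ A.colSpace := by
  rw [colSpace_mul]
  exact LinearMap.map_le_range

theorem colSpace_add_le (A B : Matrix m n K) : (A + B).colSpace ≤ A.colSpace ⊔ B.colSpace := by
  rintro _ ⟨x, rfl⟩
  rw [mulVecLin_apply, add_mulVec]
  exact Submodule.add_mem_sup (mulVec_mem_colSpace A x) (mulVec_mem_colSpace B x)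

theorem colSpace_sub_le (A B : Matrix m n K) : (A - B).colSpace ≤ A.colSpace ⊔ B.colSpace := by
  rintro _ ⟨x, rfl⟩
  rw [mulVecLin_apply, sub_mulVec]
  exact Submodule.sub_mem_sup (mulVec_mem_colSpace A x) (mulVec_mem_colSpace B x)

theorem rank_le_of_colSpace_le {A : Matrix l m K} {B : Matrix l n K}
    (h : A.colSpace ≤ B.colSpace) : A.rank ≤ B.rank :=
  Submodule.finrank_mono h

theorem rank_add_le_add (A B : Matrix m n K) : (A + B).rank ≤ A.rank + B.rank :=
  (Submodule.finrank_mono (colSpace_add_le A B)).trans (Submodule.finrank_add_le_finrank_add_finrank _ _)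

theorem rank_sub_le_add (A B : Matrix m n K) : (A - B).rank ≤ A.rank + B.rank :=
  (Submodule.finrank_mono (colSpace_sub_le A B)).trans (Submodule.finrank_add_le_finrank_add_finrank _ _)

theorem _root_.Submodule.finrank_map_add_finrank_inf_ker {V W : Type*} [AddCommGroup V] [Module K V]
    [AddCommGroup W] [Module K W] [FiniteDimensional K V] (f : V →ₗ[K] W) (U : Submodule K V) :
    finrank K (U.map f) + finrank K ↥(U ⊓ LinearMap.ker f) = finrank K U := by
  have h := LinearMap.finrank_range_add_finrank_ker (f.domRestrict U)
  rw [LinearMap.range_domRestrict, LinearMap.ker_domRestrict] at h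
  rw [← h, ← Submodule.map_comap_subtype,
    (Submodule.equivMapOfInjective _ U.injective_subtype _).finrank_eq]

theorem rank_mul_add_finrank_inf_ker (A : Matrix l m K) (B : Matrix m n K) :
    (A * B).rank + finrank K ↥(B.colSpace ⊓ LinearMap.ker A.mulVecLin) = B.rank := by
  rw [← finrank_colSpace, colSpace_mul, Submodule.finrank_map_add_finrank_inf_ker, finrank_colSpace]

theorem vecMulVec_mulVec_eq (u : m → K) (v x : n → K) : vecMulVec u v *ᵥ x = (v ⬝ᵥ x) • u := by
  rw [vecMulVec_mulVec, op_smul_eq_smul]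

/-- A vector outside a subspace is separated from it by the dot product with a vector. -/
theorem exists_dotProduct_eq_one [DecidableEq m] {W : Submodule K (m → K)} {w : m → K} (hw : w ∉ W) :
    ∃ y : m → K, y ⬝ᵥ w = 1 ∧ ∀ z ∈ W, y ⬝ᵥ z = 0 := by
  obtain ⟨f, hf, hW⟩ := Submodule.exists_le_ker_of_notMem hw
  have key : ∀ z, (fun i => (f w)⁻¹ * f (fun j => if i = j then 1 else 0)) ⬝ᵥ z =
      (f w)⁻¹ * f z := by
    intro z
    rw [LinearMap.pi_apply_eq_sum_univ f z, Finset.mul_sum]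
    refine Finset.sum_congr rfl fun i _ => ?_
    rw [smul_eq_mul]
    ring
  refine ⟨_, (key w).trans (inv_mul_cancel₀ hf), fun z hz => ?_⟩
  rw [key, LinearMap.mem_ker.1 (hW hz), mul_zero]

/-- A vector y orthogonal to the columns of `X` with y · u = 1 is sent to `v` by the transposed
update. -/
theorem colSpace_transpose_add_vecMulVec [DecidableEq m] (X : Matrix m n K) {u : m → K}
    (v : n → K) (hu : u ∉ X.colSpace) :
    (X + vecMulVec u v)ᵀ.colSpace = Xᵀ.colSpace ⊔ K ∙ v := by
  have hmul : ∀ y, (X + vecMulVec u v)ᵀ *ᵥ y = Xᵀ *ᵥ y + (u ⬝ᵥ y) • v := by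
    intro y
    rw [transpose_add, transpose_vecMulVec, add_mulVec, vecMulVec_mulVec_eq]
  obtain ⟨y, hy, hX⟩ := exists_dotProduct_eq_one hu
  have hXy : Xᵀ *ᵥ y = 0 := by
    rw [mulVec_transpose]
    refine dotProduct_eq_zero _ fun x => ?_
    rw [← dotProduct_mulVec]
    exact hX _ (mulVec_mem_colSpace X x)
  have hv : v ∈ (X + vecMulVec u v)ᵀ.colSpace := by
    refine ⟨y, ?_⟩
    rw [mulVecLin_apply, hmul, hXy, dotProduct_comm, hy, one_smul, zero_add]
  apply le_antisymm
  · rintro _ ⟨x, rfl⟩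
    rw [mulVecLin_apply, hmul]
    exact Submodule.add_mem_sup (mulVec_mem_colSpace _ _)
      (Submodule.smul_mem _ _ (Submodule.mem_span_singleton_self v))
  · refine sup_le ?_ ((Submodule.span_singleton_le_iff_mem _ _).2 hv)
    rintro _ ⟨x, rfl⟩
    have : Xᵀ *ᵥ x = (X + vecMulVec u v)ᵀ *ᵥ x - (u ⬝ᵥ x) • v := by
      rw [hmul, add_sub_cancel_right]
    rw [mulVecLin_apply, this]
    exact Submodule.sub_mem _ (mulVec_mem_colSpace _ _) (Submodule.smul_mem _ _ hv)

theorem rank_add_vecMulVec [DecidableEq m] {X : Matrix m n K} {u : m → K} {v : n → K}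
    (hu : u ∉ X.colSpace) (hv : v ∉ Xᵀ.colSpace) : (X + vecMulVec u v).rank = X.rank + 1 := by
  rw [← finrank_colSpace_transpose, colSpace_transpose_add_vecMulVec X v hu,
    Submodule.finrank_sup_span_singleton hv, finrank_colSpace_transpose]

theorem rank_mul_of_injective {P : Matrix l m K} (hP : Function.Injective P.mulVec)
    (A : Matrix m n K) : (P * A).rank = A.rank := by
  rw [← finrank_colSpace, colSpace_mul]
  exact (Submodule.equivMapOfInjective P.mulVecLin hP _).finrank_eq.symm

theorem rank_mul_of_transpose_injective {Q : Matrix m n K} (hQ : Function.Injective Qᵀ.mulVec)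
    (A : Matrix l m K) : (A * Q).rank = A.rank := by
  rw [← rank_transpose, transpose_mul, rank_mul_of_injective hQ, rank_transpose]

end Matrix

/-! ### Kernel pairs and Frobenius' inequality. -/

namespace Matrix

variable {K : Type*} [Field K] {a b k l m n : Type*}
  [Fintype a] [Fintype b] [Fintype k] [Fintype l] [Fintype m] [Fintype n]

theorem colSpace_vecMulVec_le (u : m → K) (v : n → K) : (vecMulVec u v).colSpace ≤ K ∙ u := by
  rintro _ ⟨x, rfl⟩
  rw [mulVecLin_apply, vecMulVec_mulVec_eq]
  exact Submodule.smul_mem _ _ (Submodule.mem_span_singleton_self u)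

theorem mul_vecMulVec_mul (P : Matrix a m K) (u : m → K) (v : n → K) (Q : Matrix n b K) :
    P * vecMulVec u v * Q = vecMulVec (P *ᵥ u) (Qᵀ *ᵥ v) := by
  rw [mul_vecMulVec, vecMulVec_mul, mulVec_transpose]

theorem exists_notMem_of_finrank_lt {W : Submodule K (n → K)} (h : finrank K W < Fintype.card n) :
    ∃ v, v ∉ W := by
  by_contra! hW
  rw [(Submodule.eq_top_iff').2 hW, finrank_top, finrank_fintype_fun_eq_card] at h
  exact h.false

/-- The rank of a matrix can be raised by `d` by adding columns from a subspace `U`, while enlarging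
the sum of the row space and a given subspace `V` as much as possible. -/
theorem exists_add_rank_eq [DecidableEq m] (X : Matrix m n K) (U : Submodule K (m → K))
    (V : Submodule K (n → K)) (d : ℕ) (hU : X.rank + d ≤ finrank K ↥(X.colSpace ⊔ U))
    (hV : finrank K ↥(Xᵀ.colSpace ⊔ V) + d ≤ Fintype.card n) :
    ∃ Y : Matrix m n K, Y.colSpace ≤ U ∧ Y.rank ≤ d ∧ (X + Y).rank = X.rank + d ∧
      finrank K ↥((X + Y)ᵀ.colSpace ⊔ V) = finrank K ↥(Xᵀ.colSpace ⊔ V) + d := by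
  induction d with
  | zero =>
    refine ⟨0, ?_, by rw [rank_zero], by rw [add_zero, add_zero], by rw [add_zero, add_zero]⟩
    rw [colSpace, mulVecLin_zero, LinearMap.range_zero]
    exact bot_le
  | succ d ih =>
    obtain ⟨Y, hYU, hYd, hYr, hYV⟩ := ih (by omega) (by omega)
    -- Otherwise `X + Y`, of rank only `X.rank + d`, would have all of `X.colSpace ⊔ U` in its
    -- column space.
    have hnot : ¬ U ≤ (X + Y).colSpace := by
      intro hle
      have h1 : X.colSpace ≤ (X + Y).colSpace := by
        have := colSpace_sub_le (X + Y) Y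
        rw [add_sub_cancel_right] at this
        exact this.trans (sup_le le_rfl (hYU.trans hle))
      have h2 := Submodule.finrank_mono (sup_le h1 hle)
      rw [finrank_colSpace] at h2
      omega
    obtain ⟨u, huU, hu⟩ := SetLike.not_le_iff_exists.1 hnot
    obtain ⟨v, hv⟩ := exists_notMem_of_finrank_lt
      (W := (X + Y)ᵀ.colSpace ⊔ V) (by omega)
    refine ⟨Y + vecMulVec u v, ?_, ?_, ?_, ?_⟩
    · refine (colSpace_add_le _ _).trans (sup_le hYU ((colSpace_vecMulVec_le u v).trans ?_))
      exact (Submodule.span_singleton_le_iff_mem _ _).2 huU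
    · have := rank_add_le_add Y (vecMulVec u v)
      have := rank_vecMulVec_le u v
      omega
    · rw [← add_assoc, rank_add_vecMulVec hu fun h => hv (Submodule.mem_sup_left h), hYr, add_assoc]
    · rw [← add_assoc, colSpace_transpose_add_vecMulVec _ v hu, sup_right_comm,
        Submodule.finrank_sup_span_singleton hv, hYV, add_assoc]

/-- `P` is injective and its column space is the kernel of `S`. -/
structure IsKernelPair (P : Matrix a m K) (S : Matrix k a K) : Prop where
  injective : Function.Injective P.mulVec
  colSpace_eq : P.colSpace = LinearMap.ker S.mulVecLin

namespace IsKernelPair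

variable {P : Matrix a m K} {S : Matrix k a K} (h : IsKernelPair P S)
include h

theorem mul_eq_zero : S * P = 0 := by
  classical
  refine ext_of_mulVec_single fun i => ?_
  rw [← mulVec_mulVec, zero_mulVec]
  have : P *ᵥ Pi.single i 1 ∈ LinearMap.ker S.mulVecLin :=
    h.colSpace_eq ▸ mulVec_mem_colSpace P _
  exact this

theorem exists_mulVec_eq {w : a → K} (hw : S *ᵥ w = 0) : ∃ u, P *ᵥ u = w := by
  have : w ∈ P.colSpace := h.colSpace_eq ▸ (LinearMap.mem_ker.2 hw)
  exact this

theorem rank_eq_card : P.rank = Fintype.card m := by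
  rw [← finrank_colSpace, LinearMap.finrank_range_of_inj (f := P.mulVecLin) h.injective,
    finrank_fintype_fun_eq_card]

theorem mul_sub_mul_mul (M : Matrix a b K) (X : Matrix m n K) (Q : Matrix n b K) :
    S * (M - P * X * Q) = S * M := by
  rw [Matrix.mul_sub, ← Matrix.mul_assoc, ← Matrix.mul_assoc, h.mul_eq_zero, Matrix.zero_mul,
    Matrix.zero_mul, sub_zero]

theorem rank_le (F : Matrix a b K) : F.rank ≤ (S * F).rank + Fintype.card m := by
  rw [← rank_mul_add_finrank_inf_ker S F, ← h.colSpace_eq, ← h.rank_eq_card]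
  exact Nat.add_le_add_left (Submodule.finrank_mono inf_le_right) _

theorem finrank_comap_colSpace_add (F : Matrix a b K) :
    (S * F).rank + finrank K ↥(F.colSpace.comap P.mulVecLin) = F.rank := by
  rw [← rank_mul_add_finrank_inf_ker S F, ← h.colSpace_eq, inf_comm, ← Submodule.map_comap_eq,
    (Submodule.equivMapOfInjective P.mulVecLin h.injective _).finrank_eq]

end IsKernelPair

/-- Frobenius' rank inequality. -/
theorem rank_mul_add_rank_mul_le (S : Matrix k a K) (F : Matrix a b K) (N : Matrix b l K) :
    (S * F).rank + (F * N).rank ≤ F.rank + (S * F * N).rank := by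
  have h1 := rank_mul_add_finrank_inf_ker S F
  have h2 := rank_mul_add_finrank_inf_ker S (F * N)
  have h3 := Submodule.finrank_mono
    (inf_le_inf_right (LinearMap.ker S.mulVecLin) (colSpace_mul_le F N))
  rw [← Matrix.mul_assoc] at h2
  omega

end Matrix

/-! ### Bounds for the rank of M - P X Q, and its maximum. -/

namespace Matrix

variable {K : Type*} [Field K] {a b k l m n : Type*}
  [Fintype a] [Fintype b] [Fintype k] [Fintype l] [Fintype m] [Fintype n]

theorem transpose_sub_mul_mul (M : Matrix a b K) (P : Matrix a m K) (X : Matrix m n K)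
    (Q : Matrix n b K) : (M - P * X * Q)ᵀ = Mᵀ - Qᵀ * Xᵀ * Pᵀ := by
  rw [transpose_sub, transpose_mul, transpose_mul, Matrix.mul_assoc]

theorem rank_mul_mul_le (P : Matrix a m K) (X : Matrix m n K) (Q : Matrix n b K) :
    (P * X * Q).rank ≤ X.rank :=
  (rank_mul_le_left _ _).trans (rank_mul_le_right _ _)

theorem rank_le_rank_sub_mul_mul_add (M : Matrix a b K) (P : Matrix a m K) (X : Matrix m n K)
    (Q : Matrix n b K) : M.rank ≤ (M - P * X * Q).rank + X.rank := by
  have := rank_add_le_add (M - P * X * Q) (P * X * Q)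
  rw [sub_add_cancel] at this
  exact this.trans (Nat.add_le_add_left (rank_mul_mul_le P X Q) _)

theorem rank_sub_mul_mul_le (M : Matrix a b K) (P : Matrix a m K) (X : Matrix m n K)
    (Q : Matrix n b K) : (M - P * X * Q).rank ≤ M.rank + X.rank :=
  (rank_sub_le_add _ _).trans (Nat.add_le_add_left (rank_mul_mul_le P X Q) _)

theorem exists_notMem_of_ne_top [Infinite K] {U W : Submodule K (m → K)} (hU : U ≠ ⊤)
    (hW : W ≠ ⊤) : ∃ x, x ∉ U ∧ x ∉ W := by
  obtain ⟨x, hx⟩ := Submodule.exists_forall_notMem_of_forall_ne_top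
    (fun i : Bool => cond i U W) (by rintro (_ | _) <;> assumption)
  exact ⟨x, hx true, hx false⟩

/-- A suitable multiple of a rank one matrix can be added without lowering the rank. -/
theorem exists_ne_zero_rank_le_add_smul [CharZero K] (W : Matrix m n K) (u : m → K) (v : n → K) :
    ∃ c : K, c ≠ 0 ∧ W.rank ≤ (W + c • vecMulVec u v).rank := by
  classical
  by_cases hu : u ∈ W.colSpace
  · obtain ⟨x, rfl⟩ := hu
    -- At most one `c` is excluded, so 1 or 2 works.
    obtain ⟨c, hc, hcx⟩ : ∃ c : K, c ≠ 0 ∧ 1 + c * (v ⬝ᵥ x) ≠ 0 := by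
      by_cases h : 1 + v ⬝ᵥ x = 0
      · refine ⟨2, two_ne_zero, fun h2 => one_ne_zero (α := K) ?_⟩
        linear_combination 2 * h - h2
      · exact ⟨1, one_ne_zero, by rwa [one_mul]⟩
    refine ⟨c, hc, rank_le_of_colSpace_le ?_⟩
    rintro _ ⟨y, rfl⟩
    -- The Sherman–Morrison preimage of `W *ᵥ y`.
    refine ⟨y - (c * (v ⬝ᵥ y) / (1 + c * (v ⬝ᵥ x))) • x, ?_⟩
    rw [mulVecLin_apply, mulVecLin_apply, mulVecLin_apply, add_mulVec, smul_mulVec,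
      vecMulVec_mulVec_eq, mulVec_sub, mulVec_smul, dotProduct_sub, dotProduct_smul, smul_smul,
      sub_add, ← sub_smul, smul_eq_mul]
    have : c * (v ⬝ᵥ y) / (1 + c * (v ⬝ᵥ x)) -
        c * (v ⬝ᵥ y - c * (v ⬝ᵥ y) / (1 + c * (v ⬝ᵥ x)) * (v ⬝ᵥ x)) = 0 := by
      field_simp
      ring
    rw [this, zero_smul, sub_zero]
  · refine ⟨1, one_ne_zero, ?_⟩
    rw [one_smul, ← rank_transpose W, ← rank_transpose (W + _)]
    refine rank_le_of_colSpace_le ?_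
    rw [colSpace_transpose_add_vecMulVec W v hu]
    exact le_sup_left

variable {P : Matrix a m K} {S : Matrix k a K} {Q : Matrix n b K} {N : Matrix b l K}

theorem IsKernelPair.sub_mul_mul_mul (hQ : IsKernelPair Qᵀ Nᵀ) (M : Matrix a b K)
    (P : Matrix a m K) (X : Matrix m n K) : (M - P * X * Q) * N = M * N := by
  have h0 : Q * N = 0 := by
    rw [← transpose_eq_zero, transpose_mul, hQ.mul_eq_zero]
  rw [Matrix.sub_mul, Matrix.mul_assoc (P * X), h0, Matrix.mul_zero, sub_zero]

theorem IsKernelPair.rank_le' (hQ : IsKernelPair Qᵀ Nᵀ) (F : Matrix a b K) :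
    F.rank ≤ (F * N).rank + Fintype.card n := by
  have := hQ.rank_le Fᵀ
  rwa [← transpose_mul, rank_transpose, rank_transpose] at this

/-- With F = M - P X Q, S maps col M + col F onto col SM, and its kernel there contains the columns
of P X Q, so this sum has dimension at least r(SM) + r(X). The intersection col M ∩ col F contains
col MN = col FN. -/
theorem IsKernelPair.rank_add_rank_add_rank_le (hP : IsKernelPair P S) (hQ : IsKernelPair Qᵀ Nᵀ)
    (M : Matrix a b K) (X : Matrix m n K) :
    (S * M).rank + (M * N).rank + X.rank ≤ M.rank + (M - P * X * Q).rank := by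
  set F := M - P * X * Q with hF
  have hFN : F * N = M * N := hQ.sub_mul_mul_mul M P X
  have hSF : S * F = S * M := hP.mul_sub_mul_mul M X Q
  have hX : X.rank ≤ finrank K ↥((M.colSpace ⊔ F.colSpace) ⊓ LinearMap.ker S.mulVecLin) := by
    rw [← rank_mul_of_injective hP.injective X, ← rank_mul_of_transpose_injective hQ.injective]
    refine Submodule.finrank_mono (le_inf ?_ ?_)
    · have := colSpace_sub_le M F
      rwa [hF, sub_sub_cancel, ← hF] at this
    · rw [← hP.colSpace_eq, Matrix.mul_assoc]
      exact colSpace_mul_le _ _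
  have h1 := Submodule.finrank_map_add_finrank_inf_ker S.mulVecLin (M.colSpace ⊔ F.colSpace)
  rw [Submodule.map_sup, ← colSpace_mul, ← colSpace_mul, hSF, sup_idem, finrank_colSpace] at h1
  have h2 := Submodule.finrank_sup_add_finrank_inf_eq M.colSpace F.colSpace
  have h3 : (M * N).rank ≤ finrank K ↥(M.colSpace ⊓ F.colSpace) :=
    Submodule.finrank_mono (le_inf (colSpace_mul_le _ _) (hFN ▸ colSpace_mul_le _ _))
  rw [finrank_colSpace, finrank_colSpace] at h2
  omega

/-- The maximum of the rank of `M - P * X * Q` over matrices `X` of given rank is attained. -/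
theorem IsKernelPair.exists_rank_eq_and_le_rank [CharZero K] (hP : IsKernelPair P S)
    (hQ : IsKernelPair Qᵀ Nᵀ) (M : Matrix a b K) {t : ℕ} (htm : t ≤ Fintype.card m)
    (htn : t ≤ Fintype.card n) :
    ∃ X : Matrix m n K, X.rank = t ∧
      min ((S * M).rank + Fintype.card m) (min ((M * N).rank + Fintype.card n) (M.rank + t)) ≤
        (M - P * X * Q).rank := by
  classical
  induction t with
  | zero =>
    refine ⟨0, rank_zero, ?_⟩
    rw [Matrix.mul_zero, Matrix.zero_mul, sub_zero]
    omega
  | succ t ih =>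
    obtain ⟨X, hX, hle⟩ := ih (by omega) (by omega)
    have hcol : X.colSpace ≠ ⊤ := fun h => by
      have := congrArg (fun W : Submodule K (m → K) => finrank K W) h
      simp only [finrank_colSpace, finrank_top, finrank_fintype_fun_eq_card] at this
      omega
    have hrow : Xᵀ.colSpace ≠ ⊤ := fun h => by
      have := congrArg (fun W : Submodule K (n → K) => finrank K W) h
      simp only [finrank_colSpace_transpose, finrank_top, finrank_fintype_fun_eq_card] at this
      omega
    set F := M - P * X * Q with hF
    have hstep : ∀ u v, M - P * (X + vecMulVec u v) * Q =
        F + vecMulVec (P *ᵥ (-u)) (Qᵀ *ᵥ v) := by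
      intro u v
      rw [hF, Matrix.mul_add, Matrix.add_mul, mul_vecMulVec_mul, mulVec_neg, neg_vecMulVec]
      abel
    have hSF : S * F = S * M := hP.mul_sub_mul_mul M X Q
    have hFN : F * N = M * N := hQ.sub_mul_mul_mul M P X
    have h1 := hP.finrank_comap_colSpace_add F
    have h2 := hQ.finrank_comap_colSpace_add Fᵀ
    rw [← transpose_mul, rank_transpose, rank_transpose, hFN] at h2
    rw [hSF] at h1
    -- If saturated, the rank of `F` already equals one of the first two bounds and need only not
    -- drop; otherwise one update raises the ranks of both `X` and `F`.
    by_cases hsat : F.colSpace.comap P.mulVecLin = ⊤ ∨ Fᵀ.colSpace.comap Qᵀ.mulVecLin = ⊤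
    · obtain ⟨u, hu⟩ := exists_notMem_of_ne_top hcol hcol
      obtain ⟨v, hv⟩ := exists_notMem_of_ne_top hrow hrow
      obtain ⟨c, hc, hrank⟩ := exists_ne_zero_rank_le_add_smul F (P *ᵥ (-u)) (Qᵀ *ᵥ v)
      refine ⟨X + vecMulVec (c • u) v, ?_, ?_⟩
      · rw [rank_add_vecMulVec _ hv.1, hX]
        exact fun h => hu.1 ((Submodule.smul_mem_iff _ hc).1 h)
      · rw [hstep, ← smul_neg, mulVec_smul, smul_vecMulVec]
        rcases hsat with hsat | hsat
        · rw [hsat, finrank_top, finrank_fintype_fun_eq_card] at h1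
          omega
        · rw [hsat, finrank_top, finrank_fintype_fun_eq_card] at h2
          omega
    · rw [not_or] at hsat
      obtain ⟨u, hu, huF⟩ := exists_notMem_of_ne_top hcol hsat.1
      obtain ⟨v, hv, hvF⟩ := exists_notMem_of_ne_top hrow hsat.2
      refine ⟨X + vecMulVec u v, by rw [rank_add_vecMulVec hu hv, hX], ?_⟩
      have huF' : P *ᵥ (-u) ∉ F.colSpace := by
        rw [mulVec_neg, neg_mem_iff]
        exact huF
      have hF1 := rank_add_vecMulVec (v := Qᵀ *ᵥ v) huF' hvF
      rw [hstep]
      omega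

end Matrix

/-! ### The minimal rank of M - P X Q. -/

namespace Matrix

variable {K : Type*} [Field K] {a b k l m n : Type*}
  [Fintype a] [Fintype b] [Fintype k] [Fintype l] [Fintype m] [Fintype n]
  {P : Matrix a m K} {S : Matrix k a K} {Q : Matrix n b K} {N : Matrix b l K}

/-- The rank of `M` can be lowered by `d` by subtracting `P * X * Q` with `X` of rank `d`, as long
as Frobenius' inequality permits it. -/
theorem IsKernelPair.exists_rank_sub_add_eq (hP : IsKernelPair P S) (hQ : IsKernelPair Qᵀ Nᵀ)
    (M : Matrix a b K) (d : ℕ) (hd : (S * M).rank + (M * N).rank + d ≤ M.rank + (S * M * N).rank) :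
    ∃ X : Matrix m n K, X.rank = d ∧ (M - P * X * Q).rank + d = M.rank := by
  classical
  induction d with
  | zero => exact ⟨0, rank_zero, by rw [Matrix.mul_zero, Matrix.zero_mul, sub_zero, add_zero]⟩
  | succ d ih =>
    obtain ⟨X, hX, hXM⟩ := ih (by omega)
    set F := M - P * X * Q with hF
    have hSF : S * F = S * M := hP.mul_sub_mul_mul M X Q
    have hFN : F * N = M * N := hQ.sub_mul_mul_mul M P X
    have h1 := rank_mul_add_finrank_inf_ker S F
    have h2 := rank_mul_add_finrank_inf_ker S (M * N)
    rw [hSF] at h1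
    rw [← Matrix.mul_assoc] at h2
    -- The slack in Frobenius' inequality makes col F ∩ ker S larger than col MN ∩ ker S.
    have hnot : ¬ F.colSpace ⊓ LinearMap.ker S.mulVecLin ≤ (M * N).colSpace := fun hle => by
      have := Submodule.finrank_mono (le_inf hle inf_le_right)
      omega
    obtain ⟨_, ⟨⟨x, rfl⟩, hSx⟩, hx⟩ := SetLike.not_le_iff_exists.1 hnot
    rw [mulVecLin_apply] at hx hSx
    obtain ⟨u, hu⟩ := hP.exists_mulVec_eq hSx
    obtain ⟨y, hy, hyH⟩ := exists_dotProduct_eq_one hx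
    have hyN : Nᵀ *ᵥ (Fᵀ *ᵥ y) = 0 := by
      rw [mulVec_mulVec, ← transpose_mul, hFN, mulVec_transpose]
      refine dotProduct_eq_zero _ fun z => ?_
      rw [← dotProduct_mulVec]
      exact hyH _ (mulVec_mem_colSpace _ z)
    obtain ⟨v, hv⟩ := hQ.exists_mulVec_eq hyN
    have hstep : M - P * (X + vecMulVec u v) * Q = F - vecMulVec (F *ᵥ x) (Fᵀ *ᵥ y) := by
      rw [Matrix.mul_add, Matrix.add_mul, mul_vecMulVec_mul, hu, hv, hF, sub_sub]
    have hmul : ∀ z, (M - P * (X + vecMulVec u v) * Q) *ᵥ z =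
        F *ᵥ z - (y ⬝ᵥ F *ᵥ z) • F *ᵥ x := by
      intro z
      rw [hstep, sub_mulVec, vecMulVec_mulVec_eq, mulVec_transpose, dotProduct_mulVec]
    -- Wedderburn's rank reduction: the new column space lies in that of `F` and is orthogonal to
    -- `y`, hence misses `F *ᵥ x`.
    have hlt : (M - P * (X + vecMulVec u v) * Q).rank < F.rank := by
      refine Submodule.finrank_lt_finrank_of_lt (SetLike.lt_iff_le_and_exists.2
        ⟨?_, F *ᵥ x, mulVec_mem_colSpace F x, ?_⟩)
      · rintro _ ⟨z, rfl⟩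
        rw [mulVecLin_apply, hmul]
        exact Submodule.sub_mem _ (mulVec_mem_colSpace F z)
          (Submodule.smul_mem _ _ (mulVec_mem_colSpace F x))
      · rintro ⟨z, hz⟩
        rw [mulVecLin_apply, hmul] at hz
        have := congrArg (y ⬝ᵥ ·) hz
        simp only [dotProduct_sub, dotProduct_smul, hy, smul_eq_mul, mul_one, sub_self] at this
        exact zero_ne_one this
    have hrX := rank_add_le_add X (vecMulVec u v)
    have hr1 := rank_vecMulVec_le u v
    have hrM := rank_le_rank_sub_mul_mul_add M P (X + vecMulVec u v) Q
    exact ⟨X + vecMulVec u v, by omega, by omega⟩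

/-- The columns of MN stay in the column space of M - P X Q for every X, so changes inside them cost
nothing. -/
theorem IsKernelPair.rank_sub_mul_add_mul_le (hQ : IsKernelPair Qᵀ Nᵀ) (M : Matrix a b K)
    (P : Matrix a m K) (X Y : Matrix m n K)
    (hY : Y.colSpace ≤ (M * N).colSpace.comap P.mulVecLin) :
    (M - P * (X + Y) * Q).rank ≤ (M - P * X * Q).rank := by
  refine rank_le_of_colSpace_le ?_
  have hN : (M * N).colSpace ≤ (M - P * X * Q).colSpace := by
    rw [← hQ.sub_mul_mul_mul M P X]
    exact colSpace_mul_le _ _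
  rw [Matrix.mul_add, Matrix.add_mul, ← sub_sub]
  refine (colSpace_sub_le _ _).trans (sup_le le_rfl (le_trans ?_ hN))
  refine (colSpace_mul_le _ _).trans ?_
  rw [colSpace_mul]
  exact Submodule.map_le_iff_le_comap.2 hY

theorem IsKernelPair.rank_sub_mul_add_mul_le_of_transpose (hP : IsKernelPair P S)
    (M : Matrix a b K) (X Y : Matrix m n K) (Q : Matrix n b K)
    (hY : Yᵀ.colSpace ≤ (S * M)ᵀ.colSpace.comap Qᵀ.mulVecLin) :
    (M - P * (X + Y) * Q).rank ≤ (M - P * X * Q).rank := by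
  rw [transpose_mul] at hY
  have := IsKernelPair.rank_sub_mul_add_mul_le (Q := Pᵀ) (N := Sᵀ) hP Mᵀ Qᵀ Xᵀ Yᵀ hY
  rwa [← transpose_add, ← transpose_sub_mul_mul, ← transpose_sub_mul_mul, rank_transpose,
    rank_transpose] at this

/-- When every unit of rank of `X` lowers the rank of `M`, col F and col PX meet trivially, where F
= M - P X Q; and col MN lies in col F. So the free directions are independent of those already used.
-/
theorem IsKernelPair.finrank_colSpace_sup (hP : IsKernelPair P S) (hQ : IsKernelPair Qᵀ Nᵀ)
    (M : Matrix a b K) (X : Matrix m n K) (hX : (M - P * X * Q).rank + X.rank = M.rank) :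
    finrank K ↥(X.colSpace ⊔ (M * N).colSpace.comap P.mulVecLin) =
      X.rank + finrank K ↥((M * N).colSpace.comap P.mulVecLin) := by
  rw [← finrank_colSpace X, ← Submodule.finrank_sup_add_finrank_inf_eq, left_eq_add]
  set F := M - P * X * Q with hF
  have hN : (M * N).colSpace ≤ F.colSpace := by
    rw [← hQ.sub_mul_mul_mul M P X]
    exact colSpace_mul_le _ _
  have h1 := Submodule.finrank_sup_add_finrank_inf_eq F.colSpace (P * X).colSpace
  have h2 : M.rank ≤ finrank K ↥(F.colSpace ⊔ (P * X).colSpace) := by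
    have := (colSpace_add_le F (P * X * Q)).trans (sup_le_sup_left (colSpace_mul_le (P * X) Q) _)
    rw [hF, sub_add_cancel, ← hF] at this
    exact Submodule.finrank_mono this
  rw [finrank_colSpace, finrank_colSpace, rank_mul_of_injective hP.injective] at h1
  have h3 : finrank K ↥(F.colSpace ⊓ (P * X).colSpace) = 0 := by omega
  rw [← Nat.le_zero, ← h3,
    (Submodule.equivMapOfInjective P.mulVecLin hP.injective _).finrank_eq]
  refine Submodule.finrank_mono ?_
  rintro _ ⟨_, ⟨⟨x, rfl⟩, hu⟩, rfl⟩
  refine ⟨hN hu, x, ?_⟩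
  rw [mulVecLin_mul, LinearMap.comp_apply]

/-- The minimum of the rank of `M - P * X * Q` over matrices `X` of given rank is attained. -/
theorem IsKernelPair.exists_rank_eq_and_rank_le (hP : IsKernelPair P S)
    (hQ : IsKernelPair Qᵀ Nᵀ) (M : Matrix a b K) {t : ℕ} (htm : t ≤ Fintype.card m)
    (htn : t ≤ Fintype.card n) :
    ∃ X : Matrix m n K, X.rank = t ∧
      ((M - P * X * Q).rank + (S * M * N).rank ≤ (S * M).rank + (M * N).rank ∨
        (M - P * X * Q).rank + M.rank ≤ (S * M).rank + (M * N).rank + t ∨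
        (M - P * X * Q).rank + t ≤ M.rank) := by
  classical
  have hFrob := rank_mul_add_rank_mul_le S M N
  by_cases ht : (S * M).rank + (M * N).rank + t ≤ M.rank + (S * M * N).rank
  · obtain ⟨X, hX, hXM⟩ := hP.exists_rank_sub_add_eq hQ M t ht
    exact ⟨X, hX, Or.inr (Or.inr hXM.le)⟩
  obtain ⟨X₁, hX₁, hXM₁⟩ := hP.exists_rank_sub_add_eq hQ M
    (M.rank + (S * M * N).rank - ((S * M).rank + (M * N).rank)) (by omega)
  set U := (M * N).colSpace.comap P.mulVecLin
  set V := (S * M)ᵀ.colSpace.comap Qᵀ.mulVecLin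
  have hUr : (S * M * N).rank + finrank K U = (M * N).rank := by
    rw [Matrix.mul_assoc]
    exact hP.finrank_comap_colSpace_add (M * N)
  have hVr : (S * M * N).rank + finrank K V = (S * M).rank := by
    have := hQ.finrank_comap_colSpace_add (S * M)ᵀ
    rwa [← transpose_mul, rank_transpose, rank_transpose] at this
  have hsupU : finrank K ↥(X₁.colSpace ⊔ U) = X₁.rank + finrank K U :=
    hP.finrank_colSpace_sup hQ M X₁ (by omega)
  have hsupV : finrank K ↥(X₁ᵀ.colSpace ⊔ V) = X₁.rank + finrank K V := by
    have := IsKernelPair.finrank_colSpace_sup (P := Qᵀ) (S := Nᵀ) (Q := Pᵀ) (N := Sᵀ) hQ hP Mᵀ X₁ᵀ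
      (by rw [← transpose_sub_mul_mul, rank_transpose, rank_transpose, rank_transpose]; omega)
    rwa [← transpose_mul, rank_transpose] at this
  have hcardV : finrank K ↥(X₁ᵀ.colSpace ⊔ V) ≤ Fintype.card n := by
    rw [← finrank_fintype_fun_eq_card K]
    exact Submodule.finrank_le _
  -- The second term is `X₁.rank` + dim `U` + dim `V`, the rank available at no cost.
  set s := min t (M.rank - (S * M * N).rank) with hs
  -- The last cap lets the rows added with columns from `U` stay independent of `V`; whichever term
  -- is the minimum, `V` can supply the remaining rank up to `s`.
  set d₁ := min (s - X₁.rank) (min (finrank K U) (Fintype.card n - (X₁.rank + finrank K V)))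
    with hd₁
  obtain ⟨Y₁, hYU, -, hYr₁, hYV⟩ := exists_add_rank_eq X₁ U V d₁ (by omega) (by omega)
  have hF₂ := hQ.rank_sub_mul_add_mul_le M P X₁ Y₁ hYU
  set X₂ := X₁ + Y₁ with hX₂
  obtain ⟨Y₂, hY₂V, -, hYr₂, -⟩ := exists_add_rank_eq X₂ᵀ V ⊥ (s - X₂.rank)
    (by rw [rank_transpose]; omega)
    (by rw [sup_bot_eq, transpose_transpose, finrank_colSpace]; omega)
  have hF₃ := hP.rank_sub_mul_add_mul_le_of_transpose M X₂ Y₂ᵀ Q hY₂V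
  rw [← rank_transpose, transpose_add, transpose_transpose, rank_transpose] at hYr₂
  set X₃ := X₂ + Y₂ᵀ with hX₃
  -- The last `t - s` units are arbitrary, each costing at most one.
  obtain ⟨Y₃, -, hYd₃, hYr₃, -⟩ := exists_add_rank_eq X₃ ⊤ ⊥ (t - X₃.rank)
    (by rw [sup_top_eq, finrank_top, finrank_fintype_fun_eq_card]; omega)
    (by rw [sup_bot_eq, finrank_colSpace_transpose]; omega)
  have hF₄ := rank_sub_mul_mul_le (M - P * X₃ * Q) P Y₃ Q
  rw [sub_sub, ← Matrix.add_mul, ← Matrix.mul_add] at hF₄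
  refine ⟨X₃ + Y₃, by omega, ?_⟩
  omega

end Matrix

/-! ### Diagonal and difference maps as a kernel pair. -/

namespace Matrix

/-- The matrix of the diagonal map `x ↦ (x, x)`. -/
abbrev diagonalMap (K m : Type*) [Field K] [DecidableEq m] : Matrix (m ⊕ m) m K :=
  fromRows (1 : Matrix m m K) (1 : Matrix m m K)

/-- The matrix of the difference map `(x, y) ↦ x - y`. -/
abbrev differenceMap (K m : Type*) [Field K] [DecidableEq m] : Matrix m (m ⊕ m) K :=
  fromCols (1 : Matrix m m K) (-1 : Matrix m m K)

theorem isKernelPair_diagonalMap {K m : Type*} [Field K] [Fintype m] [DecidableEq m] :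
    IsKernelPair (diagonalMap K m) (differenceMap K m) where
  injective x y hxy := by
    rw [fromRows_mulVec, fromRows_mulVec, one_mulVec, one_mulVec] at hxy
    exact (Sum.elim_eq_iff.1 hxy).1
  colSpace_eq := by
    ext w
    constructor
    · rintro ⟨x, rfl⟩
      rw [LinearMap.mem_ker, mulVecLin_apply, mulVecLin_apply, mulVec_mulVec, fromCols_mul_fromRows,
        Matrix.mul_one, Matrix.mul_one, add_neg_cancel, zero_mulVec]
    · intro hw
      rw [LinearMap.mem_ker, mulVecLin_apply, fromCols_mulVec, one_mulVec, neg_mulVec, one_mulVec,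
        add_neg_eq_zero] at hw
      refine ⟨w ∘ Sum.inl, ?_⟩
      rw [mulVecLin_apply, fromRows_mulVec, one_mulVec]
      conv_lhs => rw [hw]
      conv_rhs => rw [← Sum.elim_comp_inl_inr w, hw]

end Matrix

/-! ### Block identities for `phi`, and the theorem. -/

section PhiBlocks

open Matrix

variable {m n : ℕ} (A B C D X : Matrix (Fin m) (Fin n) ℂ)

theorem phi_eq_matM_sub :
    phi A B C D X =
      matM A B C D - diagonalMap ℂ (Fin m) * X * (diagonalMap ℂ (Fin n))ᵀ := by
  rw [phi, matM, transpose_fromRows, fromRows_mul, fromRows_mul_fromCols,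
    sub_eq_add_neg (fromBlocks A B C D), fromBlocks_neg, fromBlocks_add]
  simp only [Matrix.one_mul, Matrix.mul_one, transpose_one, sub_eq_add_neg]

theorem differenceMap_mul_matM :
    differenceMap ℂ (Fin m) * matM A B C D = matG A B C D := by
  rw [matM, matG, fromCols_mul_fromBlocks]
  simp only [Matrix.one_mul, Matrix.neg_mul, sub_eq_add_neg]

theorem matM_mul_transpose_differenceMap :
    matM A B C D * (differenceMap ℂ (Fin n))ᵀ = matH A B C D := by
  rw [matM, matH, transpose_fromCols, fromBlocks_mul_fromRows]
  simp only [Matrix.mul_one, Matrix.mul_neg, transpose_neg, transpose_one, sub_eq_add_neg]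

theorem matG_mul_transpose_differenceMap :
    matG A B C D * (differenceMap ℂ (Fin n))ᵀ = A - B - C + D := by
  rw [matG, transpose_fromCols, fromCols_mul_fromRows, transpose_neg, transpose_one,
    Matrix.mul_one, Matrix.mul_neg, Matrix.mul_one]
  abel

end PhiBlocks

open Matrix in
theorem theorem4p2 (m n t : ℕ) (ht : t ≤ min m n)
    (A B C D : Matrix (Fin m) (Fin n) ℂ) :
    IsGreatest ((fun X => (phi A B C D X).rank) '' fixedRank m n t)
      (min ((matG A B C D).rank + m)
        (min ((matH A B C D).rank + n) ((matM A B C D).rank + t))) ∧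
    IsLeast ((fun X => ((phi A B C D X).rank : ℤ)) '' fixedRank m n t)
      (max (((matG A B C D).rank : ℤ) + (matH A B C D).rank - (A - B - C + D).rank)
        (max (((matG A B C D).rank : ℤ) + (matH A B C D).rank - (matM A B C D).rank + t)
          (((matM A B C D).rank : ℤ) - t))) := by
  obtain ⟨htm, htn⟩ := le_min_iff.1 ht
  have hP := isKernelPair_diagonalMap (K := ℂ) (m := Fin m)
  have hQ : IsKernelPair (diagonalMap ℂ (Fin n))ᵀᵀ (differenceMap ℂ (Fin n))ᵀᵀ :=
    isKernelPair_diagonalMap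
  have hS : ∀ X, differenceMap ℂ (Fin m) * phi A B C D X = matG A B C D := fun X => by
    rw [phi_eq_matM_sub, hP.mul_sub_mul_mul, differenceMap_mul_matM]
  have hN : ∀ X, phi A B C D X * (differenceMap ℂ (Fin n))ᵀ = matH A B C D := fun X => by
    rw [phi_eq_matM_sub, hQ.sub_mul_mul_mul, matM_mul_transpose_differenceMap]
  have hupper : ∀ X, (phi A B C D X).rank ≤ min ((matG A B C D).rank + m)
      (min ((matH A B C D).rank + n) ((matM A B C D).rank + X.rank)) := fun X => by
    have h1 := hP.rank_le (phi A B C D X)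
    have h2 := hQ.rank_le' (phi A B C D X)
    have h3 := rank_sub_mul_mul_le (matM A B C D) (diagonalMap ℂ (Fin m)) X (diagonalMap ℂ (Fin n))ᵀ
    rw [hS, Fintype.card_fin] at h1
    rw [hN, Fintype.card_fin] at h2
    rw [← phi_eq_matM_sub] at h3
    exact le_min h1 (le_min h2 h3)
  have hlower : ∀ X, (matG A B C D).rank + (matH A B C D).rank ≤
        (phi A B C D X).rank + (A - B - C + D).rank ∧
      (matG A B C D).rank + (matH A B C D).rank + X.rank ≤
        (matM A B C D).rank + (phi A B C D X).rank ∧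
      (matM A B C D).rank ≤ (phi A B C D X).rank + X.rank := fun X => by
    have h1 := rank_mul_add_rank_mul_le (differenceMap ℂ (Fin m)) (phi A B C D X) (differenceMap ℂ (Fin n))ᵀ
    have h2 := hP.rank_add_rank_add_rank_le hQ (matM A B C D) X
    have h3 := rank_le_rank_sub_mul_mul_add (matM A B C D) (diagonalMap ℂ (Fin m)) X (diagonalMap ℂ (Fin n))ᵀ
    rw [hS, hN, matG_mul_transpose_differenceMap] at h1
    rw [differenceMap_mul_matM, matM_mul_transpose_differenceMap, ← phi_eq_matM_sub] at h2
    rw [← phi_eq_matM_sub] at h3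
    exact ⟨h1, h2, h3⟩
  constructor
  · obtain ⟨X, hX, hle⟩ := hP.exists_rank_eq_and_le_rank hQ (matM A B C D) (t := t)
      (by rwa [Fintype.card_fin]) (by rwa [Fintype.card_fin])
    rw [differenceMap_mul_matM, matM_mul_transpose_differenceMap, ← phi_eq_matM_sub, Fintype.card_fin,
      Fintype.card_fin] at hle
    refine ⟨⟨X, hX, le_antisymm ((hupper X).trans_eq (by rw [hX])) hle⟩, ?_⟩
    rintro _ ⟨X, rfl, rfl⟩
    exact hupper X
  · obtain ⟨X, hX, hle⟩ := hP.exists_rank_eq_and_rank_le hQ (matM A B C D) (t := t)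
      (by rwa [Fintype.card_fin]) (by rwa [Fintype.card_fin])
    rw [differenceMap_mul_matM, matG_mul_transpose_differenceMap,
      matM_mul_transpose_differenceMap, ← phi_eq_matM_sub] at hle
    constructor
    · refine ⟨X, hX, ?_⟩
      have := hlower X
      dsimp only
      omega
    · rintro _ ⟨X, rfl, rfl⟩
      have := hlower X
      dsimp only
      omega
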